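/- Let $\mathcal H=\mathcal H_1\oplus\mathcal H_2$ be the (Hilbert) direct sum of two real separable Hilbert spaces, with projectors $\Pi_i\colon\mathcal H\to\mathcal H_i$, and let $(X_1,X_2)$ be an $\mathcal H$-valued Gaussian random variable with mean $m=(m_1,m_2)$ and covariance operator $\mathcal C$, i.e. $\langle y,\mathcal Cx\rangle=\mathbb E\big(\langle y,X-m\rangle\langle X-m,x\rangle\big)$ with $X=(X_1,X_2)$. The operator $\mathcal C$ is automatically self-adjoint and positive definite in the sense $\langle x,\mathcal Cx\rangle\ge 0$; it is allowed to be degenerate. Put $\mathcal C_{ij}=\Pi_i\mathcal C\Pi_j^*$. Let $\mathcal C_{22}^{1/2}$ be the positive square root of $\mathcal C_{22}$, and let $\mathcal C_{22}^{-1/2}\colon\operatorname{range}\mathcal C_{22}^{1/2}\to(\ker\mathcal C_{22}^{1/2})^\perp$ be its (pseudo-)inverse, which is the usual inverse if $\mathcal C_{22}$ is injective. Let $B\colon\mathcal H_2\to\mathcal H_1$ be the bounded extension of $\mathcal C_{12}\mathcal C_{22}^{-1/2}$, that is, the bounded operator with $B\,\mathcal C_{22}^{1/2}=\mathcal C_{12}$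 and $B=0$ on $(\operatorname{range}\mathcal C_{22}^{1/2})^\perp$. On the Cameron–Martin space $\mathcal H_0=\operatorname{range}\mathcal C_{22}^{1/2}\subseteq\mathcal H_2$ define the linear operator $\mathcal C_{12}\mathcal C_{22}^{-1}:=B\,\mathcal C_{22}^{-1/2}$, and define the bounded operator $\mathcal C_{12}\mathcal C_{22}^{-1}\mathcal C_{21}:=BB^*$ on $\mathcal H_1$. A *measurable extension* of $\mathcal C_{12}\mathcal C_{22}^{-1}$ is a Borel measurable linear map $A\colon D\to\mathcal H_1$ on a Borel measurable linear subspace $D\subseteq\mathcal H_2$ with $\mathcal H_0\subseteq D$, $A=\mathcal C_{12}\mathcal C_{22}^{-1}$ on $\mathcal H_0$, and $\mathbb P(X_2-m_2\in D)=1$. Then: 1. a measurable extension of $\mathcal C_{12}\mathcal C_{22}^{-1}$ exists; 2. for every measurable extension $A$ of $\mathcal C_{12}\mathcal C_{22}^{-1}$, almost surely $X_2-m_2\in D$ and the (regular) conditional distribution of $X_1$ given $X_2$ is Gaussian with mean $$m_{1|2}=m_1+\mathcal C_{12}\mathcal C_{22}^{-1}(X_2-m_2):=m_1+A(X_2-m_2)$$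 and covariance operator $$\mathcal C_{1|2}=\mathcal C_{11}-\mathcal C_{12}\mathcal C_{22}^{-1}\mathcal C_{21}.$$ -/

import Mathlib

open MeasureTheory ProbabilityTheory
open scoped InnerProductSpace

namespace GaussCond

noncomputable section

/-- `ν` is a Gaussian measure on the Hilbert space `E`, with mean `m` and covariance operator `C`:
`⟪y, C x⟫ = 𝔼 (⟪y, Z - m⟫ ⟪Z - m, x⟫)` for `Z` of law `ν`.  (Dirac measures are Gaussian.) -/
structure IsGaussianWith {E : Type*} [NormedAddCommGroup E] [InnerProductSpace ℝ E]
    [MeasurableSpace E] (ν : Measure E) (m : E) (C : E →L[ℝ] E) : Prop where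
  isGaussian : IsGaussian ν
  integrable : Integrable (fun z : E => z) ν
  mean : ∫ z, z ∂ν = m
  cov_integrable : ∀ x y : E, Integrable (fun z : E => ⟪y, z - m⟫_ℝ * ⟪z - m, x⟫_ℝ) ν
  cov : ∀ x y : E, ⟪y, C x⟫_ℝ = ∫ z, ⟪y, z - m⟫_ℝ * ⟪z - m, x⟫_ℝ ∂ν

/-- A covariance operator is automatically positive (semidefinite) and self-adjoint. -/
theorem IsGaussianWith.isPositive {E : Type*} [NormedAddCommGroup E] [InnerProductSpace ℝ E]
    [CompleteSpace E] [MeasurableSpace E] {ν : Measure E} {m : E} {C : E →L[ℝ] E}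
    (h : IsGaussianWith ν m C) : C.IsPositive := by
  rw [ContinuousLinearMap.isPositive_iff]
  refine ⟨fun x y => ?_, fun x => ?_⟩
  · change ⟪C x, y⟫_ℝ = ⟪x, C y⟫_ℝ
    rw [real_inner_comm, h.cov, h.cov]
    refine integral_congr_ae (Filter.Eventually.of_forall fun z => ?_)
    simp only [real_inner_comm x, real_inner_comm y]
    ring
  · rw [real_inner_comm, h.cov]
    refine integral_nonneg fun z => ?_
    simp only [real_inner_comm x (z - m)]
    exact mul_self_nonneg _

section Sqrt

variable {E F : Type*} [NormedAddCommGroup E] [InnerProductSpace ℝ E] [CompleteSpace E]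
  [NormedAddCommGroup F] [InnerProductSpace ℝ F] [CompleteSpace F]

theorem exists_sq_of_norm_le_one (X : E →L[ℝ] E) (hX : ‖X‖ ≤ 1) (hs : IsSelfAdjoint X) :
    ∃ Y : E →L[ℝ] E, IsSelfAdjoint Y ∧ ‖Y‖ ≤ 1 ∧ (1 - Y) * (1 - Y) = 1 - X := by
  let f : (E →L[ℝ] E) → (E →L[ℝ] E) := fun Y => (1 / 2 : ℝ) • (X + Y * Y)
  let g : ℝ → ℝ := fun y => (1 / 2 : ℝ) * (1 + y * y)
  let Y : ℕ → (E →L[ℝ] E) := fun n => f^[n] 0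
  let y : ℕ → ℝ := fun n => g^[n] 0
  have hY : ∀ n, Y (n + 1) = (1 / 2 : ℝ) • (X + Y n * Y n) := fun n =>
    Function.iterate_succ_apply' f n 0
  have hy : ∀ n, y (n + 1) = (1 / 2 : ℝ) * (1 + y n * y n) := fun n =>
    Function.iterate_succ_apply' g n 0
  have hY0 : Y 0 = 0 := rfl
  have hy0 : y 0 = 0 := rfl
  have hyb : ∀ n, 0 ≤ y n ∧ y n ≤ 1 := by
    intro n
    induction n with
    | zero => simp [hy0]
    | succ n ih => rw [hy]; constructor <;> nlinarith [ih.1, ih.2]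
  have hYb : ∀ n, ‖Y n‖ ≤ y n := by
    intro n
    induction n with
    | zero => simp [hY0, hy0]
    | succ n ih =>
      rw [hY, hy, norm_smul, Real.norm_of_nonneg (by norm_num)]
      have h1 := norm_add_le X (Y n * Y n)
      have h2 := norm_mul_le (Y n) (Y n)
      nlinarith [norm_nonneg (Y n), (hyb n).1]
  have hd : ∀ n, ‖Y (n + 1) - Y n‖ ≤ y (n + 1) - y n := by
    intro n
    induction n with
    | zero =>
      rw [hY, hy, hY0, hy0]
      simp only [mul_zero, add_zero, sub_zero, norm_smul]
      rw [Real.norm_of_nonneg (by norm_num)]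
      linarith
    | succ n ih =>
      have e : Y (n + 1 + 1) - Y (n + 1) =
          (1 / 2 : ℝ) • (Y (n + 1) * (Y (n + 1) - Y n) + (Y (n + 1) - Y n) * Y n) := by
        rw [hY (n + 1)]
        nth_rewrite 3 [hY n]
        rw [← smul_sub]
        congr 1
        noncomm_ring
      have e' : y (n + 1 + 1) - y (n + 1) =
          (1 / 2 : ℝ) * (y (n + 1) * (y (n + 1) - y n) + (y (n + 1) - y n) * y n) := by
        rw [hy (n + 1)]
        nth_rewrite 3 [hy n]
        ring
      rw [e, e', norm_smul, Real.norm_of_nonneg (by norm_num)]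
      have h1 := norm_add_le (Y (n + 1) * (Y (n + 1) - Y n)) ((Y (n + 1) - Y n) * Y n)
      have h2 := norm_mul_le (Y (n + 1)) (Y (n + 1) - Y n)
      have h3 := norm_mul_le (Y (n + 1) - Y n) (Y n)
      have h4 : ‖Y (n + 1)‖ * ‖Y (n + 1) - Y n‖ ≤ y (n + 1) * (y (n + 1) - y n) :=
        mul_le_mul (hYb _) ih (norm_nonneg _) (hyb _).1
      have h5 : ‖Y (n + 1) - Y n‖ * ‖Y n‖ ≤ (y (n + 1) - y n) * y n :=
        mul_le_mul ih (hYb _) (norm_nonneg _) ((norm_nonneg _).trans ih)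
      linarith
  have hsum : Summable fun n => y (n + 1) - y n := by
    refine summable_of_sum_range_le (c := 1) (fun n => (norm_nonneg _).trans (hd n)) fun n => ?_
    rw [Finset.sum_range_sub, hy0, sub_zero]
    exact (hyb n).2
  have hc : CauchySeq Y := by
    refine cauchySeq_of_dist_le_of_summable _ (fun n => ?_) hsum
    rw [dist_comm, dist_eq_norm]
    exact hd n
  obtain ⟨Z, hZ⟩ := cauchySeq_tendsto_of_complete hc
  have hZ1 : Filter.Tendsto (fun n => Y (n + 1)) Filter.atTop (nhds Z) :=
    hZ.comp (Filter.tendsto_add_atTop_nat 1)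
  have hZ2 : Filter.Tendsto (fun n => Y (n + 1)) Filter.atTop
      (nhds ((1 / 2 : ℝ) • (X + Z * Z))) := by
    simp_rw [hY]
    exact (tendsto_const_nhds.add (hZ.mul hZ)).const_smul _
  have hfix : Z = (1 / 2 : ℝ) • (X + Z * Z) := tendsto_nhds_unique hZ1 hZ2
  refine ⟨Z, ?_, ?_, ?_⟩
  · have hsa : ∀ n, IsSelfAdjoint (Y n) := by
      intro n
      induction n with
      | zero => rw [hY0]; exact IsSelfAdjoint.zero _
      | succ n ih =>
        rw [hY]
        exact (IsSelfAdjoint.all (1 / 2 : ℝ)).smul (hs.add (ih.commute_iff ih |>.1 rfl))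
    have hcl : IsClosed {T : E →L[ℝ] E | star T = T} := isClosed_eq continuous_star continuous_id
    exact hcl.mem_of_tendsto hZ (Filter.Eventually.of_forall fun n => hsa n)
  · exact le_of_tendsto hZ.norm (Filter.Eventually.of_forall fun n => (hYb n).trans (hyb n).2)
  · have h2 : X + Z * Z = Z + Z := by
      have : (2 : ℝ) • Z = X + Z * Z := by
        nth_rewrite 1 [hfix]
        rw [smul_smul]
        norm_num
      rw [← this, two_smul]
    have : X = Z + Z - Z * Z := eq_sub_of_add_eq h2
    rw [this]
    noncomm_ring

/-- Cauchy-Schwarz for the form of a positive operator. -/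
theorem inner_sq_le_of_isPositive {T : E →L[ℝ] E} (hT : T.IsPositive) (x y : E) :
    ⟪T x, y⟫_ℝ ^ 2 ≤ ⟪T x, x⟫_ℝ * ⟪T y, y⟫_ℝ := by
  have key : ∀ t : ℝ, 0 ≤ ⟪T y, y⟫_ℝ * (t * t) + (2 * ⟪T x, y⟫_ℝ) * t + ⟪T x, x⟫_ℝ := by
    intro t
    have h := hT.inner_nonneg_left (x + t • y)
    have h1 : ⟪T y, x⟫_ℝ = ⟪T x, y⟫_ℝ := by
      rw [hT.inner_left_eq_inner_right, real_inner_comm]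
    simp only [map_add, map_smul, inner_add_left, inner_add_right, real_inner_smul_left,
      real_inner_smul_right, h1] at h
    linarith
  have := discrim_le_zero key
  unfold discrim at this
  nlinarith

theorem exists_isPositive_sq {Q : E →L[ℝ] E} (hQ : Q.IsPositive) :
    ∃ S : E →L[ℝ] E, S.IsPositive ∧ S ∘L S = Q := by
  obtain ⟨c, hc, hQc⟩ : ∃ c : ℝ, 0 < c ∧ ‖Q‖ ≤ c := ⟨‖Q‖ + 1, by positivity, by linarith⟩
  have hbound : ∀ x, ‖Q x‖ ^ 2 ≤ c * ⟪Q x, x⟫_ℝ := by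
    intro x
    have h1 := inner_sq_le_of_isPositive hQ x (Q x)
    rw [real_inner_self_eq_norm_sq] at h1
    have h2 : ⟪Q (Q x), Q x⟫_ℝ ≤ c * ‖Q x‖ ^ 2 := by
      have h3 := real_inner_le_norm (Q (Q x)) (Q x)
      have h4 := Q.le_opNorm (Q x)
      nlinarith [norm_nonneg (Q x), mul_le_mul_of_nonneg_right hQc (norm_nonneg (Q x))]
    have h0 := hQ.inner_nonneg_left x
    rcases eq_or_ne ‖Q x‖ 0 with h | h
    · rw [h]; simp; positivity
    · have hp : 0 < ‖Q x‖ ^ 2 := by positivity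
      have h5 : ‖Q x‖ ^ 2 * ‖Q x‖ ^ 2 ≤ (c * ⟪Q x, x⟫_ℝ) * ‖Q x‖ ^ 2 := by
        nlinarith [mul_le_mul_of_nonneg_left h2 h0]
      exact le_of_mul_le_mul_right h5 hp
  have hX : ‖(1 : E →L[ℝ] E) - c⁻¹ • Q‖ ≤ 1 := by
    refine ContinuousLinearMap.opNorm_le_bound _ zero_le_one fun x => ?_
    rw [one_mul]
    refine le_of_sq_le_sq ?_ (norm_nonneg _)
    have e : ((1 : E →L[ℝ] E) - c⁻¹ • Q) x = x - c⁻¹ • Q x := by simp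
    rw [e, norm_sub_sq_real, norm_smul, real_inner_smul_right, mul_pow, Real.norm_eq_abs, sq_abs,
      real_inner_comm]
    have h0 := hQ.inner_nonneg_left x
    have h6 : c⁻¹ ^ 2 * ‖Q x‖ ^ 2 ≤ c⁻¹ * ⟪Q x, x⟫_ℝ := by
      calc c⁻¹ ^ 2 * ‖Q x‖ ^ 2 ≤ c⁻¹ ^ 2 * (c * ⟪Q x, x⟫_ℝ) := by gcongr; exact hbound x
        _ = c⁻¹ * ⟪Q x, x⟫_ℝ := by field_simp
    have h7 : 0 ≤ c⁻¹ * ⟪Q x, x⟫_ℝ := by positivity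
    linarith
  have hsa : IsSelfAdjoint ((1 : E →L[ℝ] E) - c⁻¹ • Q) :=
    (IsSelfAdjoint.one _).sub ((IsSelfAdjoint.all c⁻¹).smul hQ.isSelfAdjoint)
  obtain ⟨Y, hYs, hYn, hY⟩ := exists_sq_of_norm_le_one _ hX hsa
  rw [sub_sub_cancel] at hY
  have hpos : ((1 : E →L[ℝ] E) - Y).IsPositive := by
    rw [ContinuousLinearMap.isPositive_iff']
    refine ⟨(IsSelfAdjoint.one _).sub hYs, fun x => ?_⟩
    have h1 := real_inner_le_norm (Y x) x
    have h2 := Y.le_of_opNorm_le hYn x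
    have e : ((1 : E →L[ℝ] E) - Y) x = x - Y x := by simp
    rw [e, inner_sub_left, real_inner_self_eq_norm_sq]
    nlinarith [norm_nonneg x]
  refine ⟨Real.sqrt c • ((1 : E →L[ℝ] E) - Y), hpos.smul_of_nonneg (Real.sqrt_nonneg c), ?_⟩
  rw [← ContinuousLinearMap.mul_def, smul_mul_smul_comm, hY, Real.mul_self_sqrt hc.le, smul_smul,
    mul_inv_cancel₀ hc.ne', one_smul]

open Classical in
/-- The positive square root `Q^{1/2}` of a positive bounded operator `Q` (and `0` if `Q` is not
positive). -/
def posSqrt (Q : E →L[ℝ] E) : E →L[ℝ] E :=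
  if h : ∃ S : E →L[ℝ] E, S.IsPositive ∧ S ∘L S = Q then h.choose else 0

theorem posSqrt_isPositive {Q : E →L[ℝ] E} (hQ : Q.IsPositive) : (posSqrt Q).IsPositive := by
  have h := exists_isPositive_sq hQ
  rw [posSqrt, dif_pos h]
  exact h.choose_spec.1

theorem posSqrt_comp_self {Q : E →L[ℝ] E} (hQ : Q.IsPositive) :
    posSqrt Q ∘L posSqrt Q = Q := by
  have h := exists_isPositive_sq hQ
  rw [posSqrt, dif_pos h]
  exact h.choose_spec.2

/-- The inverse `S⁻¹` of `S`, as an unbounded operator with domain the range of `S` and values in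
`(ker S)ᗮ`.  It is the genuine inverse when `S` is injective. -/
def pinv (S : E →L[ℝ] E) : E →ₗ.[ℝ] E :=
  ((S : E →ₗ[ℝ] E).toPMap (LinearMap.ker (S : E →ₗ[ℝ] E))ᗮ).inverse

open Classical in
/-- The bounded extension of `T S⁻¹` from the range of `S` to the whole space: the bounded operator
`B` with `B S = T` that vanishes on `(range S)ᗮ` (and `0` if there is none). -/
def boundedQuot (T : E →L[ℝ] F) (S : E →L[ℝ] E) : E →L[ℝ] F :=
  if h : ∃ B : E →L[ℝ] F, B ∘L S = T ∧ ∀ x ∈ (LinearMap.range (S : E →ₗ[ℝ] E))ᗮ, B x = 0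
  then h.choose else 0

theorem exists_boundedQuot {T : E →L[ℝ] F} {S : E →L[ℝ] E} {K : ℝ}
    (h : ∀ x, ‖T x‖ ≤ K * ‖S x‖) :
    ∃ B : E →L[ℝ] F, B ∘L S = T ∧ ∀ x ∈ (LinearMap.range (S : E →ₗ[ℝ] E))ᗮ, B x = 0 := by
  let R : Submodule ℝ E := LinearMap.range (S : E →ₗ[ℝ] E)
  let V : Submodule ℝ E := R.topologicalClosure
  have hR : ∀ x, S x ∈ R := fun x => ⟨x, rfl⟩
  have hV : ∀ x, S x ∈ V := fun x => R.le_topologicalClosure (hR x)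
  let e : E →ₗ[ℝ] V := (S : E →ₗ[ℝ] E).codRestrict V hV
  have : CompleteSpace V := R.isClosed_topologicalClosure.completeSpace_coe
  have hd : DenseRange e := by
    intro v
    rw [Metric.mem_closure_iff]
    intro ε hε
    obtain ⟨b, ⟨x, rfl⟩, hb⟩ := Metric.mem_closure_iff.1 (show (v : E) ∈ closure (R : Set E) from v.2)
      ε hε
    exact ⟨e x, ⟨x, rfl⟩, hb⟩
  have hn : ∃ C, ∀ x, ‖(T : E →ₗ[ℝ] F) x‖ ≤ C * ‖e x‖ := ⟨K, h⟩
  refine ⟨(T : E →ₗ[ℝ] F).extendOfNorm e ∘L V.orthogonalProjectionOnto, ?_, ?_⟩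
  · ext x
    have h1 : V.orthogonalProjectionOnto (S x) = e x :=
      Submodule.orthogonalProjectionOnto_mem_subspace_eq_self (e x)
    simp only [ContinuousLinearMap.comp_apply, h1]
    exact LinearMap.extendOfNorm_eq hd hn x
  · intro x hx
    have h1 : x ∈ Vᗮ := by rw [Submodule.orthogonal_closure]; exact hx
    simp [Submodule.orthogonalProjectionOnto_apply_of_mem_orthogonal h1]

theorem boundedQuot_spec {T : E →L[ℝ] F} {S : E →L[ℝ] E} {K : ℝ}
    (h : ∀ x, ‖T x‖ ≤ K * ‖S x‖) :
    boundedQuot T S ∘L S = T ∧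
      ∀ x ∈ (LinearMap.range (S : E →ₗ[ℝ] E))ᗮ, boundedQuot T S x = 0 := by
  have h' := exists_boundedQuot h
  rw [boundedQuot, dif_pos h']
  exact h'.choose_spec

end Sqrt

section Blocks

variable {H₁ H₂ : Type*} [NormedAddCommGroup H₁] [InnerProductSpace ℝ H₁] [CompleteSpace H₁]
  [NormedAddCommGroup H₂] [InnerProductSpace ℝ H₂] [CompleteSpace H₂]

/-- The projector `Π₁ : H₁ ⊕ H₂ → H₁` (Hilbert direct sum). -/
abbrev proj₁ : WithLp 2 (H₁ × H₂) →L[ℝ] H₁ := WithLp.fstL 2 ℝ H₁ H₂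

/-- The projector `Π₂ : H₁ ⊕ H₂ → H₂` (Hilbert direct sum). -/
abbrev proj₂ : WithLp 2 (H₁ × H₂) →L[ℝ] H₂ := WithLp.sndL 2 ℝ H₁ H₂

/-- `C₁₁ = Π₁ C Π₁*`. -/
def block₁₁ (C : WithLp 2 (H₁ × H₂) →L[ℝ] WithLp 2 (H₁ × H₂)) : H₁ →L[ℝ] H₁ :=
  proj₁ ∘L C ∘L ContinuousLinearMap.adjoint proj₁

/-- `C₁₂ = Π₁ C Π₂*`. -/
def block₁₂ (C : WithLp 2 (H₁ × H₂) →L[ℝ] WithLp 2 (H₁ × H₂)) : H₂ →L[ℝ] H₁ :=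
  proj₁ ∘L C ∘L ContinuousLinearMap.adjoint proj₂

/-- `C₂₂ = Π₂ C Π₂*`. -/
def block₂₂ (C : WithLp 2 (H₁ × H₂) →L[ℝ] WithLp 2 (H₁ × H₂)) : H₂ →L[ℝ] H₂ :=
  proj₂ ∘L C ∘L ContinuousLinearMap.adjoint proj₂

/-- The bounded operator `C₁₂ C₂₂^{-1/2} : H₂ → H₁`. -/
def crossHalf (C : WithLp 2 (H₁ × H₂) →L[ℝ] WithLp 2 (H₁ × H₂)) : H₂ →L[ℝ] H₁ :=
  boundedQuot (block₁₂ C) (posSqrt (block₂₂ C))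

/-- The operator `C₁₂ C₂₂⁻¹ = (C₁₂ C₂₂^{-1/2}) C₂₂^{-1/2}`, defined on the Cameron-Martin space
`range C₂₂^{1/2}`. -/
def regOp (C : WithLp 2 (H₁ × H₂) →L[ℝ] WithLp 2 (H₁ × H₂)) : H₂ →ₗ.[ℝ] H₁ :=
  (crossHalf C : H₂ →ₗ[ℝ] H₁).compPMap (pinv (posSqrt (block₂₂ C)))

/-- `C₁₁ - C₁₂ C₂₂⁻¹ C₂₁`, where
`C₁₂ C₂₂⁻¹ C₂₁ = (C₁₂ C₂₂^{-1/2}) (C₂₂^{-1/2} C₂₁) = (C₁₂ C₂₂^{-1/2}) (C₁₂ C₂₂^{-1/2})*`. -/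
def condCov (C : WithLp 2 (H₁ × H₂) →L[ℝ] WithLp 2 (H₁ × H₂)) : H₁ →L[ℝ] H₁ :=
  block₁₁ C - crossHalf C ∘L ContinuousLinearMap.adjoint (crossHalf C)

theorem block₂₂_isPositive {C : WithLp 2 (H₁ × H₂) →L[ℝ] WithLp 2 (H₁ × H₂)}
    (hC : C.IsPositive) : (block₂₂ C).IsPositive :=
  hC.conj_adjoint _

/-- For positive `C`, the operator `C₁₂ C₂₂^{-1/2}` is indeed a bounded extension. -/
theorem crossHalf_spec {C : WithLp 2 (H₁ × H₂) →L[ℝ] WithLp 2 (H₁ × H₂)} (hC : C.IsPositive) :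
    crossHalf C ∘L posSqrt (block₂₂ C) = block₁₂ C ∧
      ∀ x ∈ (LinearMap.range (posSqrt (block₂₂ C) : H₂ →ₗ[ℝ] H₂))ᗮ, crossHalf C x = 0 := by
  obtain ⟨c, hc, hCc⟩ : ∃ c : ℝ, 0 < c ∧ ‖block₁₁ C‖ ≤ c :=
    ⟨‖block₁₁ C‖ + 1, by positivity, by linarith⟩
  refine boundedQuot_spec (K := Real.sqrt c) fun y => ?_
  have hS := posSqrt_isPositive (block₂₂_isPositive hC)
  have hSS := posSqrt_comp_self (block₂₂_isPositive hC)
  set S := posSqrt (block₂₂ C)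
  set u := block₁₂ C y with hu
  have h1 := inner_sq_le_of_isPositive hC (ContinuousLinearMap.adjoint proj₂ y)
    (ContinuousLinearMap.adjoint proj₁ u)
  have e1 : ⟪C (ContinuousLinearMap.adjoint proj₂ y), ContinuousLinearMap.adjoint proj₁ u⟫_ℝ
      = ‖u‖ ^ 2 := by
    rw [ContinuousLinearMap.adjoint_inner_right, ← real_inner_self_eq_norm_sq]; rfl
  have e2 : ⟪C (ContinuousLinearMap.adjoint proj₂ y), ContinuousLinearMap.adjoint proj₂ y⟫_ℝ
      = ‖S y‖ ^ 2 := by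
    rw [ContinuousLinearMap.adjoint_inner_right]
    change ⟪block₂₂ C y, y⟫_ℝ = _
    rw [← hSS, ContinuousLinearMap.comp_apply, hS.inner_left_eq_inner_right,
      real_inner_self_eq_norm_sq]
  have e3 : ⟪C (ContinuousLinearMap.adjoint proj₁ u), ContinuousLinearMap.adjoint proj₁ u⟫_ℝ
      ≤ c * ‖u‖ ^ 2 := by
    rw [ContinuousLinearMap.adjoint_inner_right]
    change ⟪block₁₁ C u, u⟫_ℝ ≤ _
    have h3 := real_inner_le_norm (block₁₁ C u) u
    have h4 := (block₁₁ C).le_of_opNorm_le hCc u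
    nlinarith [norm_nonneg u]
  rw [e1, e2] at h1
  refine le_of_sq_le_sq ?_ (by positivity)
  rw [mul_pow, Real.sq_sqrt hc.le]
  rcases eq_or_ne ‖u‖ 0 with h | h
  · rw [h]; simp; positivity
  · have hp : 0 < ‖u‖ ^ 2 := by positivity
    refine le_of_mul_le_mul_right ?_ hp
    nlinarith [mul_le_mul_of_nonneg_left e3 (sq_nonneg ‖S y‖)]

end Blocks

/-- `T` is a measurable extension of the partially defined linear operator `A` to a set of full
`μ`-measure: `T` extends `A`, its domain is a measurable linear subspace of full measure, and `T` is
linear and measurable on it. -/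
structure IsMeasurableExtension {E F : Type*} [AddCommGroup E] [Module ℝ E] [MeasurableSpace E]
    [AddCommGroup F] [Module ℝ F] [MeasurableSpace F] (μ : Measure E)
    (A T : E →ₗ.[ℝ] F) : Prop where
  extends_op : A ≤ T
  measurableSet_domain : MeasurableSet (T.domain : Set E)
  full_measure : ∀ᵐ x ∂μ, x ∈ T.domain
  measurable : Measurable fun x : T.domain => T x

end

end GaussCond

namespace GaussCond

set_option linter.unusedSectionVars false

open Filter Topology

section Basic

variable {E F : Type*} [NormedAddCommGroup E] [InnerProductSpace ℝ E] [CompleteSpace E]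
  [SecondCountableTopology E] [MeasurableSpace E] [BorelSpace E]
  [NormedAddCommGroup F] [InnerProductSpace ℝ F] [CompleteSpace F]
  [SecondCountableTopology F] [MeasurableSpace F] [BorelSpace F]

theorem IsGaussianWith.charFun_eq {ν : Measure E} {m : E} {C : E →L[ℝ] E}
    (h : IsGaussianWith ν m C) (t : E) :
    charFun ν t = Complex.exp (⟪t, m⟫_ℝ * Complex.I - ((⟪t, C t⟫_ℝ / 2 : ℝ) : ℂ)) := by
  have := h.isGaussian
  rw [IsGaussian.charFun_eq', covarianceBilin_apply IsGaussian.memLp_two_id, h.cov]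
  simp only [id_eq, h.mean]
  have : ∀ z, ⟪z - m, t⟫_ℝ = ⟪t, z - m⟫_ℝ := fun z => real_inner_comm _ _
  simp [this]

theorem isGaussianWith_of_charFun {ν : Measure E} [IsFiniteMeasure ν] {m : E} {C : E →L[ℝ] E}
    (hC : C.IsPositive)
    (h : ∀ t, charFun ν t = Complex.exp (⟪t, m⟫_ℝ * Complex.I - ((⟪t, C t⟫_ℝ / 2 : ℝ) : ℂ))) :
    IsGaussianWith ν m C := by
  let f : E →L[ℝ] E →L[ℝ] ℝ := (innerSL ℝ).bilinearComp (ContinuousLinearMap.id ℝ E) C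
  have hf_apply : ∀ x y, f x y = ⟪x, C y⟫_ℝ := fun x y => rfl
  have hf : f.toBilinForm.IsPosSemidef := by
    refine ⟨⟨fun x y => ?_⟩, ⟨fun x => ?_⟩⟩
    · change ⟪x, C y⟫_ℝ = ⟪y, C x⟫_ℝ
      rw [← hC.inner_left_eq_inner_right, real_inner_comm]
    · exact hC.inner_nonneg_right x
  have hch : ∀ t, charFun ν t = Complex.exp (⟪t, m⟫_ℝ * Complex.I - f t t / 2) := by
    intro t
    rw [h, hf_apply]
    simp
  have hG : IsGaussian ν := isGaussian_iff_gaussian_charFun.2 ⟨m, f, hf, hch⟩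
  obtain ⟨hm, hcov⟩ := gaussian_charFun_congr m f hf hch
  have hint : Integrable (fun z : E => z) ν := IsGaussian.integrable_id
  refine ⟨hG, hint, hm.symm, fun x y => ?_, fun x y => ?_⟩
  · have h2 : MemLp (fun z : E => z - m) 2 ν := IsGaussian.memLp_two_id.sub (memLp_const m)
    exact (h2.const_inner y).integrable_mul (h2.inner_const x)
  · rw [← hf_apply, hcov, covarianceBilin_apply IsGaussian.memLp_two_id]
    simp only [id_eq, ← hm, real_inner_comm x]

theorem charFun_map_clm (ν : Measure E) (T : E →L[ℝ] F) (t : F) :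
    charFun (ν.map T) t = charFun ν (T.adjoint t) := by
  rw [charFun_apply, charFun_apply, integral_map (by fun_prop)
    (Measurable.aestronglyMeasurable (by fun_prop))]
  simp only [ContinuousLinearMap.adjoint_inner_right]

theorem IsGaussianWith.map {ν : Measure E} {m : E} {C : E →L[ℝ] E}
    (h : IsGaussianWith ν m C) (T : E →L[ℝ] F) :
    IsGaussianWith (ν.map T) (T m) (T ∘L C ∘L T.adjoint) := by
  have := h.isGaussian
  refine isGaussianWith_of_charFun (h.isPositive.conj_adjoint T) fun t => ?_
  rw [charFun_map_clm, h.charFun_eq, ContinuousLinearMap.adjoint_inner_left,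
    ContinuousLinearMap.adjoint_inner_left]
  rfl

theorem IsGaussianWith.map_add_const {ν : Measure E} {m : E} {C : E →L[ℝ] E}
    (h : IsGaussianWith ν m C) (c : E) :
    IsGaussianWith (ν.map (· + c)) (m + c) C := by
  have := h.isGaussian
  have : IsProbabilityMeasure (ν.map (· + c)) := Measure.isProbabilityMeasure_map (by fun_prop)
  refine isGaussianWith_of_charFun h.isPositive fun t => ?_
  rw [charFun_map_add_const, h.charFun_eq, ← Complex.exp_add, inner_add_right, real_inner_comm c t]
  push_cast
  ring_nf

theorem IsGaussianWith.map_neg {ν : Measure E} {C : E →L[ℝ] E}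
    (h : IsGaussianWith ν 0 C) : ν.map (fun y => -y) = ν := by
  have := h.isGaussian
  have : IsProbabilityMeasure (ν.map (fun y => -y)) :=
    Measure.isProbabilityMeasure_map (by fun_prop)
  refine Measure.ext_of_charFun (funext fun t => ?_)
  have := charFun_map_clm ν (-ContinuousLinearMap.id ℝ E) t
  have e : (⇑(-ContinuousLinearMap.id ℝ E)) = fun y : E => -y := by ext; simp
  rw [e] at this
  have e2 : (-ContinuousLinearMap.id ℝ E).adjoint t = -t := by
    refine ext_inner_right ℝ fun v => ?_
    rw [ContinuousLinearMap.adjoint_inner_left]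
    simp
  rw [this, e2, h.charFun_eq, h.charFun_eq]
  simp

theorem IsGaussianWith.map_inner {ν : Measure E} {C : E →L[ℝ] E}
    (h : IsGaussianWith ν 0 C) (g : E) :
    ν.map (fun y => ⟪g, y⟫_ℝ) = gaussianReal 0 (⟪g, C g⟫_ℝ).toNNReal := by
  have := h.isGaussian
  have : IsProbabilityMeasure (ν.map (fun y => ⟪g, y⟫_ℝ)) :=
    Measure.isProbabilityMeasure_map (by fun_prop)
  refine Measure.ext_of_charFun (funext fun t => ?_)
  have h1 := charFun_map_clm ν (innerSL ℝ g) t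
  have e : (⇑(innerSL ℝ g)) = fun y : E => ⟪g, y⟫_ℝ := by ext; simp
  have e2 : (innerSL ℝ g).adjoint t = t • g := by
    refine ext_inner_right ℝ fun v => ?_
    rw [ContinuousLinearMap.adjoint_inner_left]
    simp [real_inner_smul_left, mul_comm]
  rw [e, e2, h.charFun_eq] at h1
  rw [h1, charFun_gaussianReal, Real.coe_toNNReal _ (h.isPositive.inner_nonneg_right g)]
  simp [real_inner_smul_left, real_inner_smul_right]
  ring_nf

theorem IsGaussianWith.mgf_inner {ν : Measure E} {C : E →L[ℝ] E}
    (h : IsGaussianWith ν 0 C) (g : E) (t : ℝ) :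
    mgf (fun y => ⟪g, y⟫_ℝ) ν t = Real.exp (⟪g, C g⟫_ℝ * t ^ 2 / 2) := by
  rw [mgf_gaussianReal (h.map_inner g), Real.coe_toNNReal _ (h.isPositive.inner_nonneg_right g)]
  simp

theorem IsGaussianWith.integrable_exp_inner {ν : Measure E} {C : E →L[ℝ] E}
    (h : IsGaussianWith ν 0 C) (g : E) :
    Integrable (fun y => Real.exp ⟪g, y⟫_ℝ) ν := by
  refine Integrable.of_integral_ne_zero ?_
  have := h.mgf_inner g 1
  simp only [mgf, one_mul] at this
  rw [this]
  positivity

theorem IsGaussianWith.integral_exp_inner {ν : Measure E} {C : E →L[ℝ] E}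
    (h : IsGaussianWith ν 0 C) (g : E) :
    ∫ y, Real.exp ⟪g, y⟫_ℝ ∂ν = Real.exp (⟪g, C g⟫_ℝ / 2) := by
  simpa [mgf] using h.mgf_inner g 1

theorem IsGaussianWith.integral_inner_sq {ν : Measure E} {C : E →L[ℝ] E}
    (h : IsGaussianWith ν 0 C) (g : E) :
    ∫ y, ⟪g, y⟫_ℝ ^ 2 ∂ν = ⟪g, C g⟫_ℝ := by
  rw [h.cov]
  simp only [sub_zero, real_inner_comm g, sq]

/-- Two finite measures with the same everywhere finite Laplace transform are equal. -/
theorem ext_of_integral_exp_inner {μ ν : Measure E} [IsFiniteMeasure μ] [IsFiniteMeasure ν]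
    (hμ : ∀ g, Integrable (fun y => Real.exp ⟪g, y⟫_ℝ) μ)
    (h : ∀ g, ∫ y, Real.exp ⟪g, y⟫_ℝ ∂μ = ∫ y, Real.exp ⟪g, y⟫_ℝ ∂ν) : μ = ν := by
  have h0 : μ.real Set.univ = ν.real Set.univ := by simpa using h 0
  have hzero : μ = 0 ↔ ν = 0 := by
    rw [← Measure.measure_univ_eq_zero, ← Measure.measure_univ_eq_zero,
      ← measureReal_eq_zero_iff, ← measureReal_eq_zero_iff, h0]
  refine Measure.ext_of_charFun (funext fun g => ?_)
  have hm : mgf (fun y => ⟪g, y⟫_ℝ) μ = mgf (fun y => ⟪g, y⟫_ℝ) ν := by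
    ext t
    simpa [mgf, real_inner_smul_left] using h (t • g)
  have hs : integrableExpSet (fun y => ⟪g, y⟫_ℝ) μ = Set.univ := by
    ext t
    simpa [integrableExpSet, real_inner_smul_left] using hμ (t • g)
  have hI := eqOn_complexMGF_of_mgf' hm hzero (show Complex.I ∈ _ by simp [hs])
  simp only [complexMGF] at hI
  rw [charFun_apply, charFun_apply]
  simpa only [mul_comm Complex.I, real_inner_comm g] using hI

end Basic

section ZeroOne

variable {E F : Type*} [NormedAddCommGroup E] [InnerProductSpace ℝ E] [CompleteSpace E]
  [SecondCountableTopology E] [MeasurableSpace E] [BorelSpace E]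
  [NormedAddCommGroup F] [InnerProductSpace ℝ F] [CompleteSpace F]
  [SecondCountableTopology F] [MeasurableSpace F] [BorelSpace F]

/-- The Cameron-Martin formula for shifts in the range of the covariance operator. -/
theorem IsGaussianWith.map_add_cov {ν : Measure E} {C : E →L[ℝ] E}
    (h : IsGaussianWith ν 0 C) (g : E) :
    ν.map (· + C g) =
      ν.withDensity fun y => ENNReal.ofReal (Real.exp (⟪g, y⟫_ℝ - ⟪g, C g⟫_ℝ / 2)) := by
  have := h.isGaussian
  have : IsProbabilityMeasure (ν.map (· + C g)) := Measure.isProbabilityMeasure_map (by fun_prop)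
  have hint : Integrable (fun y => Real.exp (⟪g, y⟫_ℝ - ⟪g, C g⟫_ℝ / 2)) ν := by
    simp_rw [Real.exp_sub]
    exact (h.integrable_exp_inner g).div_const _
  have := isFiniteMeasure_withDensity_ofReal hint.hasFiniteIntegral
  refine ext_of_integral_exp_inner (fun k => ?_) fun k => ?_
  · rw [integrable_map_measure (Measurable.aestronglyMeasurable (by fun_prop)) (by fun_prop)]
    simp only [Function.comp_def, inner_add_right, Real.exp_add]
    exact (h.integrable_exp_inner k).mul_const _
  · rw [integral_map (by fun_prop) (Measurable.aestronglyMeasurable (by fun_prop)),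
      integral_withDensity_eq_integral_toReal_smul (by fun_prop) (by simp)]
    have e1 : ∀ y, Real.exp ⟪k, y + C g⟫_ℝ = Real.exp ⟪k, y⟫_ℝ * Real.exp ⟪k, C g⟫_ℝ := fun y => by
      rw [inner_add_right, Real.exp_add]
    have e2 : ∀ y, (ENNReal.ofReal (Real.exp (⟪g, y⟫_ℝ - ⟪g, C g⟫_ℝ / 2))).toReal •
        Real.exp ⟪k, y⟫_ℝ = Real.exp ⟪k + g, y⟫_ℝ * Real.exp (-(⟪g, C g⟫_ℝ / 2)) := fun y => by
      rw [ENNReal.toReal_ofReal (Real.exp_pos _).le, smul_eq_mul, ← Real.exp_add, ← Real.exp_add,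
        inner_add_left]
      ring_nf
    simp_rw [e1, e2]
    rw [integral_mul_const, integral_mul_const, h.integral_exp_inner, h.integral_exp_inner,
      ← Real.exp_add, ← Real.exp_add]
    have hs : ⟪g, C k⟫_ℝ = ⟪k, C g⟫_ℝ := by
      rw [← h.isPositive.inner_left_eq_inner_right, real_inner_comm]
    simp only [map_add, inner_add_left, inner_add_right, hs]
    ring_nf

/-- A measurable set invariant under the shifts in the range of the covariance operator has measure
zero or one. -/
theorem IsGaussianWith.measure_eq_zero_or_one {ν : Measure E} {C : E →L[ℝ] E}
    (h : IsGaussianWith ν 0 C) {s : Set E} (hs : MeasurableSet s)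
    (hinv : ∀ g y, y + C g ∈ s ↔ y ∈ s) : ν s = 0 ∨ ν s = 1 := by
  have := h.isGaussian
  have key : ν.restrict s = ν s • ν := by
    have : IsFiniteMeasure (ν s • ν) := ν.smul_finite (measure_ne_top ν s)
    refine ext_of_integral_exp_inner (fun g => (h.integrable_exp_inner g).restrict) fun g => ?_
    have h1 := congrArg (fun μ : Measure E => μ s) (h.map_add_cov g)
    beta_reduce at h1
    rw [Measure.map_apply (by fun_prop) hs, withDensity_apply _ hs] at h1
    have h2 : (fun y => y + C g) ⁻¹' s = s := by ext y; exact hinv g y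
    rw [h2] at h1
    have h3 : ∫ y in s, Real.exp (⟪g, y⟫_ℝ - ⟪g, C g⟫_ℝ / 2) ∂ν = (ν s).toReal := by
      rw [h1, integral_eq_lintegral_of_nonneg_ae (ae_of_all _ fun y => (Real.exp_pos _).le)
        (Measurable.aestronglyMeasurable (by fun_prop))]
    simp_rw [Real.exp_sub] at h3
    rw [integral_div, div_eq_iff (Real.exp_pos _).ne'] at h3
    rw [h3, integral_smul_measure, h.integral_exp_inner, smul_eq_mul]
  have h4 := congrArg (fun μ : Measure E => μ s) key
  simp only [Measure.restrict_apply hs, Set.inter_self, Measure.smul_apply, smul_eq_mul] at h4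
  rcases eq_or_ne (ν s) 0 with h0 | h0
  · exact Or.inl h0
  · right
    have := (ENNReal.mul_eq_left h0 (measure_ne_top ν s)).1 h4.symm
    exact this

open Classical in
/-- The extension of a partially defined linear operator by zero. -/
noncomputable def zeroExtend (A : E →ₗ.[ℝ] F) (y : E) : F :=
  if h : y ∈ A.domain then A ⟨y, h⟩ else 0

theorem zeroExtend_of_mem {A : E →ₗ.[ℝ] F} {y : E} (h : y ∈ A.domain) :
    zeroExtend A y = A ⟨y, h⟩ := dif_pos h

theorem zeroExtend_add {A : E →ₗ.[ℝ] F} {x y : E} (hx : x ∈ A.domain) (hy : y ∈ A.domain) :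
    zeroExtend A (x + y) = zeroExtend A x + zeroExtend A y := by
  rw [zeroExtend_of_mem hx, zeroExtend_of_mem hy, zeroExtend_of_mem (add_mem hx hy), ← A.map_add]
  rfl

theorem zeroExtend_neg {A : E →ₗ.[ℝ] F} {x : E} (hx : x ∈ A.domain) :
    zeroExtend A (-x) = -zeroExtend A x := by
  rw [zeroExtend_of_mem hx, zeroExtend_of_mem (neg_mem hx), ← A.map_neg]
  rfl

theorem zeroExtend_eq_of_le {A T : E →ₗ.[ℝ] F} (h : A ≤ T) {x : E} (hx : x ∈ A.domain) :
    zeroExtend T x = zeroExtend A x := by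
  rw [zeroExtend_of_mem hx, zeroExtend_of_mem (h.1 hx)]
  exact (h.2 rfl).symm

theorem IsMeasurableExtension.measurable_zeroExtend {μ : Measure E} {A T : E →ₗ.[ℝ] F}
    (h : IsMeasurableExtension μ A T) : Measurable (zeroExtend T) := by
  classical
  exact Measurable.dite (s := (T.domain : Set E)) h.measurable measurable_const
    h.measurableSet_domain

/-- Measurable extensions are almost everywhere unique. -/
theorem IsMeasurableExtension.ae_eq {μ : Measure E} {C : E →L[ℝ] E} (hμ : IsGaussianWith μ 0 C)
    {A T₁ T₂ : E →ₗ.[ℝ] F} (hA : ∀ g, C g ∈ A.domain)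
    (h₁ : IsMeasurableExtension μ A T₁) (h₂ : IsMeasurableExtension μ A T₂) :
    zeroExtend T₁ =ᵐ[μ] zeroExtend T₂ := by
  have := hμ.isGaussian
  set f : E → F := fun y => zeroExtend T₁ y - zeroExtend T₂ y with hf
  have hfm : Measurable f := h₁.measurable_zeroExtend.sub h₂.measurable_zeroExtend
  have hD : ∀ᵐ y ∂μ, y ∈ T₁.domain ∧ y ∈ T₂.domain := h₁.full_measure.and h₂.full_measure
  have hfC : ∀ g y, y ∈ T₁.domain → y ∈ T₂.domain → f (y + C g) = f y := by
    intro g y hy₁ hy₂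
    have e : zeroExtend T₁ (C g) = zeroExtend T₂ (C g) := by
      rw [zeroExtend_eq_of_le h₁.extends_op (hA g), zeroExtend_eq_of_le h₂.extends_op (hA g)]
    simp only [hf]
    rw [zeroExtend_add hy₁ (h₁.extends_op.1 (hA g)), zeroExtend_add hy₂ (h₂.extends_op.1 (hA g)), e]
    abel
  obtain ⟨c, hc⟩ : ∃ c, f =ᵐ[μ] Function.const E c := by
    refine exists_eventuallyEq_const_of_forall_separating MeasurableSet fun U hU => ?_
    let s : Set E := {y | (y ∈ T₁.domain ∧ y ∈ T₂.domain) ∧ f y ∈ U}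
    have hs : MeasurableSet s :=
      (h₁.measurableSet_domain.inter h₂.measurableSet_domain).inter (hfm hU)
    have hinv : ∀ g y, y + C g ∈ s ↔ y ∈ s := by
      intro g y
      have e1 : y + C g ∈ T₁.domain ↔ y ∈ T₁.domain :=
        T₁.domain.add_mem_iff_left (h₁.extends_op.1 (hA g))
      have e2 : y + C g ∈ T₂.domain ↔ y ∈ T₂.domain :=
        T₂.domain.add_mem_iff_left (h₂.extends_op.1 (hA g))
      change (_ ∧ _) ∧ _ ↔ (_ ∧ _) ∧ _
      rw [e1, e2]
      refine and_congr_right fun hy => ?_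
      rw [hfC g y hy.1 hy.2]
    rcases hμ.measure_eq_zero_or_one hs hinv with h0 | h0
    · right
      filter_upwards [hD, measure_eq_zero_iff_ae_notMem.1 h0] with y hy hys hyU
      exact hys ⟨hy, hyU⟩
    · left
      filter_upwards [(mem_ae_iff_prob_eq_one hs).2 h0] with y hy
      exact hy.2
  have hc' : ∀ᵐ y ∂μ, f (-y) = c := by
    have h3 : ∀ᵐ y ∂(μ.map fun y => -y), f y = c := by rw [hμ.map_neg]; exact hc
    exact ae_of_ae_map (by fun_prop) h3
  obtain ⟨y, ⟨hy₁, hy₂⟩, h3, h4⟩ := (hD.and (hc.and hc')).exists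
  have h5 : f (-y) = -f y := by
    simp only [hf]
    rw [zeroExtend_neg hy₁, zeroExtend_neg hy₂]
    abel
  have hc0 : c = 0 := by
    rw [h4, h3] at h5
    have h6 : (2 : ℝ) • c = 0 := by
      rw [two_smul]
      nth_rewrite 1 [h5]
      exact neg_add_cancel c
    simpa using h6
  filter_upwards [hc] with y hy
  rw [hc0] at hy
  exact sub_eq_zero.1 hy

end ZeroOne

section Approximation

variable {E F : Type*} [NormedAddCommGroup E] [InnerProductSpace ℝ E] [CompleteSpace E]
  [NormedAddCommGroup F] [InnerProductSpace ℝ F] [CompleteSpace F]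

/-- The finite rank operator `y ↦ ∑ i ∈ s, ⟪g i, y⟫ b i`. -/
noncomputable def finiteRankOp {ι : Type*} (b : ι → F) (s : Finset ι) (g : ι → E) : E →L[ℝ] F :=
  ∑ i ∈ s, InnerProductSpace.rankOne ℝ (b i) (g i)

theorem finiteRankOp_apply {ι : Type*} (b : ι → F) (s : Finset ι) (g : ι → E) (y : E) :
    finiteRankOp b s g y = ∑ i ∈ s, ⟪g i, y⟫_ℝ • b i := by
  simp [finiteRankOp]

theorem norm_finiteRankOp_apply_sq {ι : Type*} {b : ι → F} (hb : Orthonormal ℝ b) (s : Finset ι)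
    (g : ι → E) (y : E) : ‖finiteRankOp b s g y‖ ^ 2 = ∑ i ∈ s, ⟪g i, y⟫_ℝ ^ 2 := by
  rw [finiteRankOp_apply, ← real_inner_self_eq_norm_sq, hb.inner_sum]
  simp [sq]

theorem inner_finiteRankOp_apply {ι : Type*} {b : ι → F} (hb : Orthonormal ℝ b) {s : Finset ι}
    {g : ι → E} (hg : ∀ i ∉ s, g i = 0) (y : E) (i : ι) :
    ⟪b i, finiteRankOp b s g y⟫_ℝ = ⟪g i, y⟫_ℝ := by
  classical
  rw [finiteRankOp_apply, inner_sum]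
  simp only [inner_smul_right, orthonormal_iff_ite.1 hb, mul_ite, mul_one, mul_zero,
    Finset.sum_ite_eq]
  split_ifs with h
  · rfl
  · simp [hg i h]

theorem finiteRankOp_eq_of_subset {ι : Type*} (b : ι → F) {s t : Finset ι} {g : ι → E}
    (hg : ∀ i ∉ s, g i = 0) (hst : s ⊆ t) : finiteRankOp b s g = finiteRankOp b t g := by
  refine Finset.sum_subset hst fun i _ hi => ?_
  simp [hg i hi]

/-- An operator with square summable rows in the closure of the range of `S` is a Hilbert-Schmidt
limit of operators of the form `T S` with `T` of finite rank. -/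
theorem exists_rows_approx {ι : Type*} (S : E →L[ℝ] E) (v : ι → E)
    (hv : Summable fun i => ‖v i‖ ^ 2)
    (hcl : ∀ i, v i ∈ closure (Set.range S)) {ε : ℝ} (hε : 0 < ε) :
    ∃ (s : Finset ι) (g : ι → E), (∀ i ∉ s, g i = 0) ∧
      ∀ t : Finset ι, ∑ i ∈ t, ‖S (g i) - v i‖ ^ 2 ≤ ε := by
  classical
  obtain ⟨s, hs⟩ := summable_iff_vanishing_norm.1 hv (ε / 2) (by positivity)
  obtain ⟨δ, hδ, hδs⟩ : ∃ δ : ℝ, 0 < δ ∧ s.card * δ ^ 2 ≤ ε / 2 := by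
    refine ⟨Real.sqrt (ε / 2 / (s.card + 1)), by positivity, ?_⟩
    rw [Real.sq_sqrt (by positivity), mul_div_assoc', div_le_iff₀ (by positivity)]
    nlinarith
  have hex : ∀ i, ∃ x, ‖S x - v i‖ < δ := by
    intro i
    obtain ⟨_, ⟨x, rfl⟩, hx⟩ := Metric.mem_closure_iff.1 (hcl i) δ hδ
    exact ⟨x, by rwa [← dist_eq_norm, dist_comm]⟩
  choose x hx using hex
  refine ⟨s, fun i => if i ∈ s then x i else 0, fun i hi => by simp [hi], fun t => ?_⟩
  rw [← Finset.sum_filter_add_sum_filter_not t (· ∈ s)]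
  have h1 : ∑ i ∈ t with i ∈ s, ‖S (if i ∈ s then x i else 0) - v i‖ ^ 2 ≤ ε / 2 := by
    calc _ ≤ ∑ i ∈ t with i ∈ s, δ ^ 2 := by
          refine Finset.sum_le_sum fun i hi => ?_
          rw [if_pos (Finset.mem_filter.1 hi).2]
          exact pow_le_pow_left₀ (norm_nonneg _) (hx i).le 2
      _ ≤ s.card * δ ^ 2 := by
          rw [Finset.sum_const, nsmul_eq_mul]
          gcongr
          exact fun i hi => (Finset.mem_filter.1 hi).2
      _ ≤ ε / 2 := hδs
  have h2 : ∑ i ∈ t with i ∉ s, ‖S (if i ∈ s then x i else 0) - v i‖ ^ 2 ≤ ε / 2 := by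
    have e : ∑ i ∈ t with i ∉ s, ‖S (if i ∈ s then x i else 0) - v i‖ ^ 2 =
        ∑ i ∈ t with i ∉ s, ‖v i‖ ^ 2 := by
      refine Finset.sum_congr rfl fun i hi => ?_
      simp [(Finset.mem_filter.1 hi).2]
    rw [e]
    refine (le_abs_self _).trans (hs _ ?_).le
    exact Finset.disjoint_left.2 fun i hi => (Finset.mem_filter.1 hi).2
  linarith

/-- The operator norm is at most the Hilbert-Schmidt norm. -/
theorem opNorm_le_of_sum_rows_le {ι : Type*} (b : HilbertBasis ι ℝ F) (T : E →L[ℝ] F) (v : ι → E)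
    (hv : ∀ i x, ⟪b i, T x⟫_ℝ = ⟪v i, x⟫_ℝ) {ε : ℝ} (hε : 0 ≤ ε)
    (h : ∀ t : Finset ι, ∑ i ∈ t, ‖v i‖ ^ 2 ≤ ε ^ 2) : ‖T‖ ≤ ε := by
  refine T.opNorm_le_bound hε fun x => ?_
  refine le_of_sq_le_sq ?_ (by positivity)
  rw [mul_pow, ← real_inner_self_eq_norm_sq]
  refine le_of_tendsto (b.hasSum_inner_mul_inner (T x) (T x)) (Eventually.of_forall fun t => ?_)
  calc ∑ i ∈ t, ⟪T x, b i⟫_ℝ * ⟪b i, T x⟫_ℝ = ∑ i ∈ t, ⟪v i, x⟫_ℝ ^ 2 := by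
        refine Finset.sum_congr rfl fun i _ => ?_
        rw [real_inner_comm, hv, sq]
    _ ≤ ∑ i ∈ t, ‖v i‖ ^ 2 * ‖x‖ ^ 2 := by
        refine Finset.sum_le_sum fun i _ => ?_
        rw [← mul_pow, ← sq_abs]
        exact pow_le_pow_left₀ (abs_nonneg _) (abs_real_inner_le_norm _ _) 2
    _ ≤ ε ^ 2 * ‖x‖ ^ 2 := by
        rw [← Finset.sum_mul]
        gcongr
        exact h t

variable [SecondCountableTopology E] [MeasurableSpace E] [BorelSpace E]
  [SecondCountableTopology F] [MeasurableSpace F] [BorelSpace F]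

theorem IsGaussianWith.integral_norm_finiteRankOp_sq {ι : Type*} {μ : Measure E} {S : E →L[ℝ] E}
    (hS : S.IsPositive) (hμ : IsGaussianWith μ 0 (S ∘L S)) {b : ι → F} (hb : Orthonormal ℝ b)
    (s : Finset ι) (g : ι → E) :
    ∫ y, ‖finiteRankOp b s g y‖ ^ 2 ∂μ = ∑ i ∈ s, ‖S (g i)‖ ^ 2 := by
  have := hμ.isGaussian
  simp_rw [norm_finiteRankOp_apply_sq hb]
  rw [integral_finsetSum]
  · refine Finset.sum_congr rfl fun i _ => ?_
    rw [hμ.integral_inner_sq, ContinuousLinearMap.comp_apply, ← hS.inner_left_eq_inner_right,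
      real_inner_self_eq_norm_sq]
  · intro i _
    have h2 : MemLp (fun z : E => z) 2 μ := IsGaussian.memLp_two_id
    exact (h2.const_inner (g i)).integrable_sq

theorem eLpNorm_two_le_of_integral_le {α : Type*} [MeasurableSpace α] {μ : Measure α} {f : α → F}
    (hf : MemLp f 2 μ) {c : ℝ} (hc : 0 ≤ c) (h : ∫ x, ‖f x‖ ^ 2 ∂μ ≤ c ^ 2) :
    eLpNorm f 2 μ ≤ ENNReal.ofReal c := by
  rw [hf.eLpNorm_eq_integral_rpow_norm (by norm_num) (by norm_num)]
  refine ENNReal.ofReal_le_ofReal ?_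
  simp only [ENNReal.toReal_ofNat, Real.rpow_two]
  rw [show ((2 : ℝ)⁻¹) = 1 / 2 by norm_num, ← Real.sqrt_eq_rpow]
  exact (Real.sqrt_le_sqrt h).trans (Real.sqrt_sq hc).le

/-- If `B` is Hilbert-Schmidt and vanishes on `(range S)ᗮ`, there are bounded operators `T n` with
`T n S → B` in norm that converge almost everywhere with respect to the Gaussian measure with
covariance `S²`. -/
theorem IsGaussianWith.exists_approx {ι : Type*} {μ : Measure E} {S : E →L[ℝ] E}
    (hS : S.IsPositive) (hμ : IsGaussianWith μ 0 (S ∘L S)) (b : HilbertBasis ι ℝ F)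
    {B : E →L[ℝ] F} (hB : ∀ x ∈ (LinearMap.range (S : E →ₗ[ℝ] E))ᗮ, B x = 0)
    (hsum : Summable fun i => ‖B.adjoint (b i)‖ ^ 2) :
    ∃ T : ℕ → E →L[ℝ] F, Tendsto (fun n => T n ∘L S) atTop (𝓝 B) ∧
      ∀ᵐ y ∂μ, ∃ l, Tendsto (fun n => T n y) atTop (𝓝 l) := by
  classical
  have := hμ.isGaussian
  have hcl : ∀ i, B.adjoint (b i) ∈ closure (Set.range S) := by
    intro i
    have h1 : B.adjoint (b i) ∈ (LinearMap.range (S : E →ₗ[ℝ] E))ᗮᗮ := by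
      rw [Submodule.mem_orthogonal]
      intro u hu
      rw [ContinuousLinearMap.adjoint_inner_right, hB u hu, inner_zero_left]
    rw [Submodule.orthogonal_orthogonal_eq_closure] at h1
    exact h1
  choose s g hg hsg using fun n : ℕ =>
    exists_rows_approx S _ hsum hcl (show (0 : ℝ) < ((1 / 2) ^ n) ^ 2 by positivity)
  refine ⟨fun n => finiteRankOp b (s n) (g n), ?_, ?_⟩
  · rw [tendsto_iff_norm_sub_tendsto_zero]
    refine squeeze_zero (fun _ => norm_nonneg _) (fun n => ?_)
      (tendsto_pow_atTop_nhds_zero_of_lt_one (r := (1 / 2 : ℝ)) (by norm_num) (by norm_num))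
    refine opNorm_le_of_sum_rows_le b _ (fun i => S (g n i) - B.adjoint (b i)) (fun i x => ?_)
      (by positivity) (hsg n)
    rw [sub_apply, ContinuousLinearMap.comp_apply, inner_sub_right,
      inner_finiteRankOp_apply b.orthonormal (hg n), inner_sub_left,
      ContinuousLinearMap.adjoint_inner_left, hS.inner_left_eq_inner_right]
  · have hL2 : ∀ T : E →L[ℝ] F, MemLp (fun y => T y) 2 μ := fun T =>
      T.comp_memLp' IsGaussian.memLp_two_id
    refine Lp.ae_tendsto_of_cauchy_eLpNorm (p := 2)
      (B := fun N => ENNReal.ofReal (3 * (1 / 2) ^ N))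
      (fun n => (hL2 _).1) (by norm_num) ?_ fun N n m hn hm => ?_
    · rw [← ENNReal.ofReal_tsum_of_nonneg (fun n => by positivity)]
      · exact ENNReal.ofReal_ne_top
      · exact (summable_geometric_of_lt_one (by norm_num) (by norm_num)).mul_left _
    · have hN : (0 : ℝ) < (1 / 2) ^ N := by positivity
      have hmono : ∀ k, N ≤ k → ∀ t : Finset ι,
          ∑ i ∈ t, ‖S (g k i) - B.adjoint (b i)‖ ^ 2 ≤ ((1 / 2) ^ N) ^ 2 := fun k hk t =>
        (hsg k t).trans (pow_le_pow_left₀ (by positivity)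
          (pow_le_pow_of_le_one (by norm_num) (by norm_num) hk) 2)
      have e : (fun y => finiteRankOp b (s n) (g n) y) - (fun y => finiteRankOp b (s m) (g m) y) =
          fun y => finiteRankOp b (s n ∪ s m) (fun i => g n i - g m i) y := by
        rw [finiteRankOp_eq_of_subset b (t := s n ∪ s m) (hg n) Finset.subset_union_left,
          finiteRankOp_eq_of_subset b (t := s n ∪ s m) (hg m) Finset.subset_union_right]
        ext y
        simp only [Pi.sub_apply, finiteRankOp_apply, inner_sub_left, sub_smul,
          Finset.sum_sub_distrib]
      rw [e]
      refine (eLpNorm_two_le_of_integral_le (hL2 _) (c := 2 * (1 / 2) ^ N) (by positivity) ?_).trans_lt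
        ((ENNReal.ofReal_lt_ofReal_iff (by positivity)).2 (by linarith))
      rw [hμ.integral_norm_finiteRankOp_sq hS b.orthonormal]
      calc ∑ i ∈ s n ∪ s m, ‖S (g n i - g m i)‖ ^ 2
          ≤ ∑ i ∈ s n ∪ s m, 2 * (‖S (g n i) - B.adjoint (b i)‖ ^ 2 +
              ‖S (g m i) - B.adjoint (b i)‖ ^ 2) := by
            refine Finset.sum_le_sum fun i _ => ?_
            have h1 := norm_sub_le (S (g n i) - B.adjoint (b i)) (S (g m i) - B.adjoint (b i))
            rw [sub_sub_sub_cancel_right, ← map_sub] at h1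
            have h2 := pow_le_pow_left₀ (norm_nonneg _) h1 2
            refine h2.trans ?_
            nlinarith [sq_nonneg (‖S (g n i) - B.adjoint (b i)‖ - ‖S (g m i) - B.adjoint (b i)‖)]
        _ ≤ (2 * (1 / 2) ^ N) ^ 2 := by
            rw [← Finset.mul_sum, Finset.sum_add_distrib]
            have h1 := hmono n hn (s n ∪ s m)
            have h2 := hmono m hm (s n ∪ s m)
            nlinarith

/-- The pointwise limit of a sequence of operators, on the subspace where it exists. -/
noncomputable def limitOp (T : ℕ → E →L[ℝ] F) : E →ₗ.[ℝ] F where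
  domain :=
    { carrier := {y | ∃ l, Tendsto (fun n => T n y) atTop (𝓝 l)}
      zero_mem' := ⟨0, by simp⟩
      add_mem' := by
        rintro x y ⟨l, hl⟩ ⟨l', hl'⟩
        exact ⟨l + l', by simpa using hl.add hl'⟩
      smul_mem' := by
        rintro c x ⟨l, hl⟩
        exact ⟨c • l, by simpa using hl.const_smul c⟩ }
  toFun :=
    { toFun := fun y => y.2.choose
      map_add' := fun x y => by
        refine tendsto_nhds_unique (x + y).2.choose_spec ?_
        simpa using x.2.choose_spec.add y.2.choose_spec
      map_smul' := fun c x => by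
        refine tendsto_nhds_unique (c • x).2.choose_spec ?_
        simpa using x.2.choose_spec.const_smul c }

theorem tendsto_limitOp {T : ℕ → E →L[ℝ] F} (y : (limitOp T).domain) :
    Tendsto (fun n => T n y) atTop (𝓝 (limitOp T y)) := y.2.choose_spec

theorem isMeasurableExtension_limitOp {μ : Measure E} {A : E →ₗ.[ℝ] F} {T : ℕ → E →L[ℝ] F}
    (hA : ∀ y : A.domain, Tendsto (fun n => T n y) atTop (𝓝 (A y)))
    (hT : ∀ᵐ y ∂μ, ∃ l, Tendsto (fun n => T n y) atTop (𝓝 l)) :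
    IsMeasurableExtension μ A (limitOp T) where
  extends_op := by
    refine ⟨fun y hy => ⟨_, hA ⟨y, hy⟩⟩, fun x y hxy => ?_⟩
    refine tendsto_nhds_unique (hA x) ?_
    rw [hxy]
    exact tendsto_limitOp y
  measurableSet_domain := measurableSet_exists_tendsto fun n => (T n).continuous.measurable
  full_measure := hT
  measurable := by
    refine measurable_of_tendsto_metrizable (f := fun n (y : (limitOp T).domain) => T n y)
      (fun n => (T n).continuous.measurable.comp measurable_subtype_coe) ?_
    exact tendsto_pi_nhds.2 fun y => tendsto_limitOp y

end Approximation

section Blocks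

variable {H₁ H₂ : Type*} [NormedAddCommGroup H₁] [InnerProductSpace ℝ H₁] [CompleteSpace H₁]
  [NormedAddCommGroup H₂] [InnerProductSpace ℝ H₂] [CompleteSpace H₂]
  {C : WithLp 2 (H₁ × H₂) →L[ℝ] WithLp 2 (H₁ × H₂)}

theorem crossHalf_posSqrt_apply (hC : C.IsPositive) (x : H₂) :
    crossHalf C (posSqrt (block₂₂ C) x) = block₁₂ C x :=
  congrArg (fun T : H₂ →L[ℝ] H₁ => T x) (crossHalf_spec hC).1

theorem norm_posSqrt_apply_sq (hC : C.IsPositive) (x : H₂) :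
    ‖posSqrt (block₂₂ C) x‖ ^ 2 = ⟪x, block₂₂ C x⟫_ℝ := by
  have hQ := block₂₂_isPositive hC
  conv_rhs => rw [← posSqrt_comp_self hQ]
  rw [ContinuousLinearMap.comp_apply, ← (posSqrt_isPositive hQ).inner_left_eq_inner_right,
    real_inner_self_eq_norm_sq]

theorem toLp_eq_adjoint_add_adjoint (t : H₁) (r : H₂) :
    WithLp.toLp 2 (t, r) = (proj₁ (H₁ := H₁) (H₂ := H₂)).adjoint t + proj₂.adjoint r := by
  refine ext_inner_right ℝ fun v => ?_
  rw [inner_add_left, ContinuousLinearMap.adjoint_inner_left,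
    ContinuousLinearMap.adjoint_inner_left, WithLp.prod_inner_apply]
  rfl

theorem inner_toLp_cov (hC : C.IsPositive) (t : H₁) (r : H₂) :
    ⟪WithLp.toLp 2 (t, r), C (WithLp.toLp 2 (t, r))⟫_ℝ = ⟪t, block₁₁ C t⟫_ℝ +
      2 * ⟪(crossHalf C).adjoint t, posSqrt (block₂₂ C) r⟫_ℝ +
      ‖posSqrt (block₂₂ C) r‖ ^ 2 := by
  rw [norm_posSqrt_apply_sq hC, ContinuousLinearMap.adjoint_inner_left,
    crossHalf_posSqrt_apply hC, toLp_eq_adjoint_add_adjoint]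
  simp only [map_add, inner_add_left, inner_add_right]
  rw [← hC.inner_left_eq_inner_right (proj₂.adjoint r) (proj₁.adjoint t),
    real_inner_comm (proj₁.adjoint t) (C (proj₂.adjoint r))]
  simp only [ContinuousLinearMap.adjoint_inner_left]
  simp only [block₁₁, block₁₂, block₂₂, ContinuousLinearMap.comp_apply]
  ring

theorem adjoint_crossHalf_mem_closure (hC : C.IsPositive) (t : H₁) :
    (crossHalf C).adjoint t ∈ closure (Set.range (posSqrt (block₂₂ C))) := by
  have h1 : (crossHalf C).adjoint t ∈
      (LinearMap.range (posSqrt (block₂₂ C) : H₂ →ₗ[ℝ] H₂))ᗮᗮ := by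
    rw [Submodule.mem_orthogonal]
    intro u hu
    rw [ContinuousLinearMap.adjoint_inner_right, (crossHalf_spec hC).2 u hu, inner_zero_left]
  rw [Submodule.orthogonal_orthogonal_eq_closure] at h1
  exact h1

theorem norm_adjoint_crossHalf_sq_le (hC : C.IsPositive) (t : H₁) :
    ‖(crossHalf C).adjoint t‖ ^ 2 ≤ ⟪t, block₁₁ C t⟫_ℝ := by
  let s : Set H₂ := {z : H₂ | 0 ≤ ⟪t, block₁₁ C t⟫_ℝ + 2 * ⟪(crossHalf C).adjoint t, -z⟫_ℝ + ‖z‖ ^ 2}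
  have hcl : IsClosed s := isClosed_le (by fun_prop) (by fun_prop)
  have hsub : Set.range (posSqrt (block₂₂ C)) ⊆ s := by
    rintro _ ⟨x, rfl⟩
    have h := hC.inner_nonneg_right (WithLp.toLp 2 (t, -x))
    rw [inner_toLp_cov hC] at h
    simpa [s] using h
  have h := hcl.closure_subset_iff.2 hsub (adjoint_crossHalf_mem_closure hC t)
  simp only [s, Set.mem_ofPred_eq, inner_neg_right, real_inner_self_eq_norm_sq] at h
  linarith

theorem inner_condCov (t : H₁) :
    ⟪t, condCov C t⟫_ℝ = ⟪t, block₁₁ C t⟫_ℝ - ‖(crossHalf C).adjoint t‖ ^ 2 := by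
  rw [condCov, sub_apply, inner_sub_right, ContinuousLinearMap.comp_apply,
    ← ContinuousLinearMap.adjoint_inner_left (crossHalf C), real_inner_self_eq_norm_sq]

theorem condCov_isPositive (hC : C.IsPositive) : (condCov C).IsPositive := by
  rw [ContinuousLinearMap.isPositive_iff']
  refine ⟨?_, fun t => ?_⟩
  · have h1 : (block₁₁ C).IsPositive := hC.conj_adjoint _
    have h2 : (crossHalf C ∘L (crossHalf C).adjoint).IsPositive :=
      ContinuousLinearMap.isPositive_self_comp_adjoint _
    exact h1.isSelfAdjoint.sub h2.isSelfAdjoint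
  · rw [real_inner_comm, inner_condCov]
    exact sub_nonneg.2 (norm_adjoint_crossHalf_sq_le hC t)

theorem mem_regOp_domain_and_apply {y : H₂} (hy : y ∈ (regOp C).domain) :
    ∃ x, y = posSqrt (block₂₂ C) x ∧ regOp C ⟨y, hy⟩ = crossHalf C x := by
  set S := posSqrt (block₂₂ C) with hS
  let f := (S : H₂ →ₗ[ℝ] H₂).toPMap (LinearMap.ker (S : H₂ →ₗ[ℝ] H₂))ᗮ
  have hker : f.toFun.ker = ⊥ := by
    refine LinearMap.ker_eq_bot'.2 fun z hz => ?_
    have h1 : (z : H₂) ∈ LinearMap.ker (S : H₂ →ₗ[ℝ] H₂) := hz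
    have h2 : (z : H₂) = 0 := by
      have := (Submodule.mem_orthogonal _ _).1 z.2 z h1
      exact inner_self_eq_zero.1 this
    exact Subtype.ext h2
  have hy' : y ∈ f.inverse.domain := hy
  have hy'' := hy'
  rw [LinearPMap.inverse_domain] at hy''
  obtain ⟨x, hx⟩ := hy''
  refine ⟨x, hx.symm, ?_⟩
  change crossHalf C (f.inverse ⟨y, hy'⟩) = _
  rw [LinearPMap.inverse_apply_eq hker (y := ⟨y, hy'⟩) (x := x) hx]

theorem posSqrt_apply_mem_regOp_domain (x : H₂) :
    posSqrt (block₂₂ C) x ∈ (regOp C).domain := by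
  set S := posSqrt (block₂₂ C) with hS
  let K : Submodule ℝ H₂ := LinearMap.ker (S : H₂ →ₗ[ℝ] H₂)
  let f := (S : H₂ →ₗ[ℝ] H₂).toPMap Kᗮ
  change S x ∈ f.inverse.domain
  rw [LinearPMap.inverse_domain]
  have hK : IsClosed (K : Set H₂) := S.isClosed_ker
  have : CompleteSpace K := hK.completeSpace_coe
  refine ⟨⟨x - K.starProjection x, K.sub_starProjection_mem_orthogonal x⟩, ?_⟩
  change S (x - K.starProjection x) = S x
  have h1 : S (K.starProjection x) = 0 := K.starProjection_apply_mem x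
  rw [map_sub, h1, sub_zero]

end Blocks

section Joint

variable {H₁ H₂ : Type*}
  [NormedAddCommGroup H₁] [InnerProductSpace ℝ H₁] [CompleteSpace H₁]
  [SecondCountableTopology H₁] [MeasurableSpace H₁] [BorelSpace H₁]
  [NormedAddCommGroup H₂] [InnerProductSpace ℝ H₂] [CompleteSpace H₂]
  [SecondCountableTopology H₂] [MeasurableSpace H₂] [BorelSpace H₂]
  {Ω : Type*} [MeasurableSpace Ω] {P : Measure Ω} [IsProbabilityMeasure P]
  {U V : Ω → H₁} {Y : Ω → H₂}
  {C : WithLp 2 (H₁ × H₂) →L[ℝ] WithLp 2 (H₁ × H₂)}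

theorem IsGaussianWith.snd (hU : AEMeasurable U P) (hY : AEMeasurable Y P)
    (hX : IsGaussianWith (P.map fun ω => WithLp.toLp 2 (U ω, Y ω)) 0 C) :
    IsGaussianWith (P.map Y) 0 (block₂₂ C) := by
  have h := hX.map proj₂
  rw [AEMeasurable.map_map_of_aemeasurable (by fun_prop) (by fun_prop), map_zero] at h
  exact h

theorem IsGaussianWith.fst (hU : AEMeasurable U P) (hY : AEMeasurable Y P)
    (hX : IsGaussianWith (P.map fun ω => WithLp.toLp 2 (U ω, Y ω)) 0 C) :
    IsGaussianWith (P.map U) 0 (block₁₁ C) := by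
  have h := hX.map proj₁
  rw [AEMeasurable.map_map_of_aemeasurable (by fun_prop) (by fun_prop), map_zero] at h
  exact h

/-- The covariance operator of a Gaussian measure has finite trace. -/
theorem IsGaussianWith.summable_inner_cov {μ : Measure H₁} {Q : H₁ →L[ℝ] H₁}
    (hμ : IsGaussianWith μ 0 Q) {ι : Type*} {b : ι → H₁} (hb : Orthonormal ℝ b) :
    Summable fun i => ⟪b i, Q (b i)⟫_ℝ := by
  have := hμ.isGaussian
  have h2 : MemLp (fun z : H₁ => z) 2 μ := IsGaussian.memLp_two_id
  refine summable_of_sum_le (c := ∫ y, ‖y‖ ^ 2 ∂μ)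
    (fun i => hμ.isPositive.inner_nonneg_right _) fun s => ?_
  simp_rw [← hμ.integral_inner_sq]
  have hint : ∀ i ∈ s, Integrable (fun y => ⟪b i, y⟫_ℝ ^ 2) μ := fun i _ =>
    (h2.const_inner (b i)).integrable_sq
  rw [← integral_finsetSum _ hint]
  refine integral_mono (integrable_finsetSum _ hint) (h2.integrable_norm_pow two_ne_zero)
    fun y => ?_
  simpa using hb.sum_inner_products_le y (s := s)

theorem IsGaussianWith.integral_cexp_residual (hU : AEMeasurable U P) (hY : AEMeasurable Y P)
    (hX : IsGaussianWith (P.map fun ω => WithLp.toLp 2 (U ω, Y ω)) 0 C)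
    {T : ℕ → H₂ →L[ℝ] H₁}
    (hT : Tendsto (fun n => T n ∘L posSqrt (block₂₂ C)) atTop (𝓝 (crossHalf C)))
    (hV : ∀ᵐ ω ∂P, Tendsto (fun n => T n (Y ω)) atTop (𝓝 (V ω))) (t : H₁) (s : H₂) :
    ∫ ω, Complex.exp (((⟪U ω - V ω, t⟫_ℝ + ⟪Y ω, s⟫_ℝ : ℝ) : ℂ) * Complex.I) ∂P =
      Complex.exp (-((⟪t, condCov C t⟫_ℝ / 2 : ℝ) : ℂ)) *
        Complex.exp (-((⟪s, block₂₂ C s⟫_ℝ / 2 : ℝ) : ℂ)) := by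
  have hC := hX.isPositive
  set S := posSqrt (block₂₂ C) with hSdef
  have hS : S.IsPositive := posSqrt_isPositive (block₂₂_isPositive hC)
  have h1 : Tendsto (fun n => ∫ ω, Complex.exp
        (((⟪U ω - T n (Y ω), t⟫_ℝ + ⟪Y ω, s⟫_ℝ : ℝ) : ℂ) * Complex.I) ∂P) atTop
      (𝓝 (∫ ω, Complex.exp (((⟪U ω - V ω, t⟫_ℝ + ⟪Y ω, s⟫_ℝ : ℝ) : ℂ) * Complex.I) ∂P)) := by
    refine tendsto_integral_of_dominated_convergence (fun _ => 1) (fun n => ?_)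
      (integrable_const 1) (fun n => ae_of_all _ fun ω => ?_) ?_
    · exact AEMeasurable.aestronglyMeasurable (by fun_prop)
    · rw [Complex.norm_exp_ofReal_mul_I]
    · filter_upwards [hV] with ω hω
      refine (Complex.continuous_exp.tendsto _).comp (Tendsto.mul_const _ ?_)
      refine (Complex.continuous_ofReal.tendsto _).comp (Tendsto.add_const _ ?_)
      exact (tendsto_const_nhds.sub hω).inner tendsto_const_nhds
  have h2 : ∀ n, ∫ ω, Complex.exp
        (((⟪U ω - T n (Y ω), t⟫_ℝ + ⟪Y ω, s⟫_ℝ : ℝ) : ℂ) * Complex.I) ∂P =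
      Complex.exp (-(((⟪t, block₁₁ C t⟫_ℝ +
        2 * ⟪(crossHalf C).adjoint t, S s - (T n ∘L S).adjoint t⟫_ℝ +
        ‖S s - (T n ∘L S).adjoint t‖ ^ 2) / 2 : ℝ) : ℂ)) := by
    intro n
    have h3 := hX.charFun_eq (WithLp.toLp 2 (t, s - (T n).adjoint t))
    rw [inner_toLp_cov hC, charFun_apply, integral_map (by fun_prop)
      (Measurable.aestronglyMeasurable (by fun_prop))] at h3
    have e : S (s - (T n).adjoint t) = S s - (T n ∘L S).adjoint t := by
      rw [map_sub, ContinuousLinearMap.adjoint_comp, hS.isSelfAdjoint.adjoint_eq]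
      rfl
    rw [← hSdef, e] at h3
    simp only [inner_zero_right, Complex.ofReal_zero, zero_mul, zero_sub] at h3
    rw [← h3]
    congr 1
    ext ω
    congr 3
    rw [WithLp.prod_inner_apply]
    simp only [inner_sub_right, inner_sub_left, ContinuousLinearMap.adjoint_inner_right]
    ring
  have h4 : Tendsto (fun n => S s - (T n ∘L S).adjoint t) atTop
      (𝓝 (S s - (crossHalf C).adjoint t)) := by
    refine tendsto_const_nhds.sub ?_
    have h5 := ((ContinuousLinearMap.adjoint (𝕜 := ℝ) (E := H₂) (F := H₁)).continuous.tendsto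
      (crossHalf C)).comp hT
    exact ((ContinuousLinearMap.apply ℝ H₂ t).continuous.tendsto _).comp h5
  simp_rw [h2] at h1
  rw [← Complex.exp_add]
  refine tendsto_nhds_unique h1 ?_
  refine (Complex.continuous_exp.tendsto _).comp ?_
  have e : -((⟪t, condCov C t⟫_ℝ / 2 : ℝ) : ℂ) + -((⟪s, block₂₂ C s⟫_ℝ / 2 : ℝ) : ℂ) =
      -(((⟪t, block₁₁ C t⟫_ℝ +
        2 * ⟪(crossHalf C).adjoint t, S s - (crossHalf C).adjoint t⟫_ℝ +
        ‖S s - (crossHalf C).adjoint t‖ ^ 2) / 2 : ℝ) : ℂ) := by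
    rw [inner_condCov, ← norm_posSqrt_apply_sq hC, norm_sub_sq_real, inner_sub_right,
      real_inner_self_eq_norm_sq, real_inner_comm (S s)]
    push_cast
    ring
  rw [e]
  refine Tendsto.neg ((Complex.continuous_ofReal.tendsto _).comp (Tendsto.div_const ?_ 2))
  exact (tendsto_const_nhds.add ((tendsto_const_nhds.inner h4).const_mul 2)).add (h4.norm.pow 2)

/-- The residual `U - V` is independent of `Y` and Gaussian with covariance `condCov C`. -/
theorem IsGaussianWith.residual (hU : AEMeasurable U P) (hY : AEMeasurable Y P)
    (hVm : AEMeasurable V P)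
    (hX : IsGaussianWith (P.map fun ω => WithLp.toLp 2 (U ω, Y ω)) 0 C)
    {T : ℕ → H₂ →L[ℝ] H₁}
    (hT : Tendsto (fun n => T n ∘L posSqrt (block₂₂ C)) atTop (𝓝 (crossHalf C)))
    (hV : ∀ᵐ ω ∂P, Tendsto (fun n => T n (Y ω)) atTop (𝓝 (V ω))) :
    IsGaussianWith (P.map fun ω => U ω - V ω) 0 (condCov C) ∧
      IndepFun Y (fun ω => U ω - V ω) P := by
  have key := hX.integral_cexp_residual hU hY hT hV
  have hW : AEMeasurable (fun ω => U ω - V ω) P := hU.sub hVm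
  have hW1 : ∀ t, charFun (P.map fun ω => U ω - V ω) t =
      Complex.exp (-((⟪t, condCov C t⟫_ℝ / 2 : ℝ) : ℂ)) := by
    intro t
    rw [charFun_apply, integral_map hW (Measurable.aestronglyMeasurable (by fun_prop))]
    simpa using key t 0
  have hY1 : ∀ s, charFun (P.map Y) s =
      Complex.exp (-((⟪s, block₂₂ C s⟫_ℝ / 2 : ℝ) : ℂ)) := by
    intro s
    rw [(IsGaussianWith.snd hU hY hX).charFun_eq]
    simp
  constructor
  · refine isGaussianWith_of_charFun (condCov_isPositive hX.isPositive) fun t => ?_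
    rw [hW1]
    simp
  · rw [indepFun_iff_charFun_prod hY hW]
    intro z
    rw [hW1, hY1, mul_comm, ← key, charFun_apply,
      integral_map (by fun_prop) (Measurable.aestronglyMeasurable (by fun_prop))]
    congr 1
    ext ω
    congr 3
    rw [WithLp.prod_inner_apply]
    simp only
    ring

end Joint

section Conditional

variable {H₁ H₂ : Type*}
  [NormedAddCommGroup H₁] [InnerProductSpace ℝ H₁] [CompleteSpace H₁]
  [SecondCountableTopology H₁] [MeasurableSpace H₁] [BorelSpace H₁]
  [NormedAddCommGroup H₂] [InnerProductSpace ℝ H₂] [CompleteSpace H₂]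
  [SecondCountableTopology H₂] [MeasurableSpace H₂] [BorelSpace H₂]
  {Ω : Type*} [MeasurableSpace Ω] {P : Measure Ω} [IsProbabilityMeasure P]
  {C : WithLp 2 (H₁ × H₂) →L[ℝ] WithLp 2 (H₁ × H₂)}

theorem IsGaussianWith.centered {X₁ : Ω → H₁} {X₂ : Ω → H₂}
    (hX₁ : AEMeasurable X₁ P) (hX₂ : AEMeasurable X₂ P) {m₁ : H₁} {m₂ : H₂}
    (hX : IsGaussianWith (P.map fun ω => WithLp.toLp 2 (X₁ ω, X₂ ω))
      (WithLp.toLp 2 (m₁, m₂)) C) :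
    IsGaussianWith (P.map fun ω => WithLp.toLp 2 (X₁ ω - m₁, X₂ ω - m₂)) 0 C := by
  have h := hX.map_add_const (-WithLp.toLp 2 (m₁, m₂))
  rw [AEMeasurable.map_map_of_aemeasurable (by fun_prop) (by fun_prop), add_neg_cancel] at h
  convert! h using 3 with ω
  rw [Function.comp_apply, ← sub_eq_add_neg, ← WithLp.toLp_sub, Prod.mk_sub_mk]

/-- There are bounded operators `T n` converging almost surely to a measurable extension of
`C₁₂ C₂₂⁻¹`, and such that `T n C₂₂^{1/2}` converges to `C₁₂ C₂₂^{-1/2}`. -/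
theorem IsGaussianWith.exists_approx_regOp {U : Ω → H₁} {Y : Ω → H₂}
    (hU : AEMeasurable U P) (hY : AEMeasurable Y P)
    (hX : IsGaussianWith (P.map fun ω => WithLp.toLp 2 (U ω, Y ω)) 0 C) :
    ∃ T : ℕ → H₂ →L[ℝ] H₁,
      Tendsto (fun n => T n ∘L posSqrt (block₂₂ C)) atTop (𝓝 (crossHalf C)) ∧
      IsMeasurableExtension (P.map Y) (regOp C) (limitOp T) := by
  have hC := hX.isPositive
  have hQ := block₂₂_isPositive hC
  obtain ⟨w, b, -⟩ := exists_hilbertBasis ℝ H₁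
  have hμ := IsGaussianWith.snd hU hY hX
  rw [← posSqrt_comp_self hQ] at hμ
  have hsum : Summable fun i => ‖(crossHalf C).adjoint (b i)‖ ^ 2 :=
    Summable.of_nonneg_of_le (fun i => sq_nonneg _)
      (fun i => norm_adjoint_crossHalf_sq_le hC (b i))
      ((IsGaussianWith.fst hU hY hX).summable_inner_cov b.orthonormal)
  obtain ⟨T, hT, hae⟩ := hμ.exists_approx (posSqrt_isPositive hQ) b (crossHalf_spec hC).2 hsum
  refine ⟨T, hT, isMeasurableExtension_limitOp (fun y => ?_) hae⟩
  obtain ⟨x, hx, hx'⟩ := mem_regOp_domain_and_apply y.2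
  rw [hx', hx]
  exact ((ContinuousLinearMap.apply ℝ H₁ x).continuous.tendsto _).comp hT

theorem cov_mem_regOp_domain (hC : C.IsPositive) (g : H₂) :
    block₂₂ C g ∈ (regOp C).domain := by
  have h := congrArg (fun T : H₂ →L[ℝ] H₂ => T g) (posSqrt_comp_self (block₂₂_isPositive hC))
  rw [← h]
  exact posSqrt_apply_mem_regOp_domain _

/-- If `Z = a(X) + W` with `W` independent of `X`, then the conditional law of `Z` given `X = x` is
the law of `a(x) + W`. -/
theorem condDistrib_ae_eq_map_add {X : Ω → H₂} {W Z : Ω → H₁} {a : H₂ → H₁}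
    (hX : AEMeasurable X P) (hW : AEMeasurable W P) (ha : Measurable a)
    (hind : IndepFun X W P) (hZ : ∀ᵐ ω ∂P, Z ω = W ω + a (X ω)) :
    ∀ᵐ ω ∂P, condDistrib Z X P (X ω) = (P.map W).map (· + a (X ω)) := by
  have : IsProbabilityMeasure (P.map W) := Measure.isProbabilityMeasure_map hW
  have : IsProbabilityMeasure (P.map X) := Measure.isProbabilityMeasure_map hX
  let κ : Kernel H₂ H₁ :=
    (Kernel.const H₂ (P.map W) ×ₖ Kernel.deterministic a ha).map fun p => p.1 + p.2
  have hκ : ∀ x, κ x = (P.map W).map (· + a x) := by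
    intro x
    rw [Kernel.map_apply _ (by fun_prop), Kernel.prod_apply, Kernel.const_apply,
      Kernel.deterministic_apply, Measure.prod_dirac, Measure.map_map (by fun_prop) (by fun_prop)]
    rfl
  have hκm : IsMarkovKernel κ := Kernel.IsMarkovKernel.map _ (by fun_prop)
  have hZm : AEMeasurable Z P :=
    (hW.add (ha.comp_aemeasurable hX)).congr (hZ.mono fun ω h => h.symm)
  have hm : Measurable fun p : H₂ × H₁ => (p.1, p.2 + a p.1) := by fun_prop
  have hjoint : P.map (fun ω => (X ω, Z ω)) = P.map X ⊗ₘ κ := by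
    have h1 : P.map (fun ω => (X ω, Z ω)) =
        ((P.map X).prod (P.map W)).map fun p : H₂ × H₁ => (p.1, p.2 + a p.1) := by
      rw [← (indepFun_iff_map_prod_eq_prod_map_map hX hW).1 hind,
        AEMeasurable.map_map_of_aemeasurable hm.aemeasurable (by fun_prop)]
      refine Measure.map_congr ?_
      filter_upwards [hZ] with ω hω
      simp [hω]
    rw [h1]
    ext s hs
    rw [Measure.map_apply hm hs, Measure.prod_apply (hm hs), Measure.compProd_apply hs]
    refine lintegral_congr fun x => ?_
    rw [hκ, Measure.map_apply (by fun_prop) (measurable_prodMk_left hs)]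
    rfl
  have h := ae_of_ae_map hX (condDistrib_ae_eq_of_measure_eq_compProd X hZm hjoint)
  filter_upwards [h] with ω hω
  rw [hω, hκ]

end Conditional

end GaussCond

theorem mainTheorem5
    {H₁ H₂ : Type*}
    [NormedAddCommGroup H₁] [InnerProductSpace ℝ H₁] [CompleteSpace H₁]
    [SecondCountableTopology H₁] [MeasurableSpace H₁] [BorelSpace H₁]
    [NormedAddCommGroup H₂] [InnerProductSpace ℝ H₂] [CompleteSpace H₂]
    [SecondCountableTopology H₂] [MeasurableSpace H₂] [BorelSpace H₂]
    {Ω : Type*} [MeasurableSpace Ω] (P : Measure Ω) [IsProbabilityMeasure P]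
    (X₁ : Ω → H₁) (X₂ : Ω → H₂)
    (hX₁ : AEMeasurable X₁ P) (hX₂ : AEMeasurable X₂ P)
    (m₁ : H₁) (m₂ : H₂)
    (C : WithLp 2 (H₁ × H₂) →L[ℝ] WithLp 2 (H₁ × H₂))
    (hX : GaussCond.IsGaussianWith (P.map fun ω => WithLp.toLp 2 (X₁ ω, X₂ ω))
      (WithLp.toLp 2 (m₁, m₂)) C) :
    -- `C₁₂ C₂₂⁻¹` has a measurable extension to a set of full measure
    (∃ A : H₂ →ₗ.[ℝ] H₁, GaussCond.IsMeasurableExtension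
      (P.map fun ω => X₂ ω - m₂) (GaussCond.regOp C) A) ∧
    -- and, whichever one is used, the conditional law is the stated Gaussian
    ∀ A : H₂ →ₗ.[ℝ] H₁, GaussCond.IsMeasurableExtension
      (P.map fun ω => X₂ ω - m₂) (GaussCond.regOp C) A →
      ∀ᵐ ω ∂P, ∃ h : X₂ ω - m₂ ∈ A.domain,
        GaussCond.IsGaussianWith (condDistrib X₁ X₂ P (X₂ ω))
          (m₁ + A ⟨X₂ ω - m₂, h⟩) (GaussCond.condCov C) := by
  have hU : AEMeasurable (fun ω => X₁ ω - m₁) P := by fun_prop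
  have hY : AEMeasurable (fun ω => X₂ ω - m₂) P := by fun_prop
  have hUY := GaussCond.IsGaussianWith.centered hX₁ hX₂ hX
  obtain ⟨T, hT, hL⟩ := hUY.exists_approx_regOp hU hY
  refine ⟨⟨_, hL⟩, fun A hA => ?_⟩
  have hμ := GaussCond.IsGaussianWith.snd hU hY hUY
  have hAm := hA.measurable_zeroExtend
  have hV := ae_of_ae_map hY <|
    (hL.ae_eq hμ (GaussCond.cov_mem_regOp_domain hX.isPositive) hA).and hL.full_measure
  obtain ⟨hW, hind⟩ := hUY.residual hU hY (hAm.comp_aemeasurable hY) hT <| by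
    filter_upwards [hV] with ω hω
    rw [Function.comp_apply, ← hω.1, GaussCond.zeroExtend_of_mem hω.2]
    exact GaussCond.tendsto_limitOp ⟨_, hω.2⟩
  have hind' : IndepFun X₂
      (fun ω => X₁ ω - m₁ - (GaussCond.zeroExtend A ∘ fun ω => X₂ ω - m₂) ω) P := by
    have := hind.comp (φ := fun y => y + m₂) (ψ := id) (by fun_prop) measurable_id
    simpa [Function.comp_def] using this
  have hcond := GaussCond.condDistrib_ae_eq_map_add (Z := X₁)
    (a := fun x => m₁ + GaussCond.zeroExtend A (x - m₂)) hX₂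
    (hU.sub (hAm.comp_aemeasurable hY)) (by fun_prop) hind'
    (Filter.Eventually.of_forall fun ω => by simp)
  filter_upwards [hcond, ae_of_ae_map hY hA.full_measure] with ω hω hmem
  refine ⟨hmem, ?_⟩
  rw [hω, ← GaussCond.zeroExtend_of_mem hmem]
  have h := hW.map_add_const (m₁ + GaussCond.zeroExtend A (X₂ ω - m₂))
  rw [zero_add] at h
  exact h
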